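/- Let $(M,\rho)$ be a metric space, let $a\le b$ be real numbers, and let $f:[a,b]\to M$ be continuous and of bounded variation. Let $E\subset[a,b]$ be a Lebesgue measurable set with $\mathcal{H}^1(f(E))=0$, where $\mathcal{H}^1$ denotes the one-dimensional Hausdorff measure on $M$. Then for (Lebesgue) almost every $x\in E$ the metric derivative $$md(f,x):=\lim_{\substack{t\to 0\\ x+t\in[a,b]}}\frac{\rho\big(f(x+t),f(x)\big)}{|t|}$$ exists and equals $0$. -/

import Mathlib

open Set Filter Topology MeasureTheory

/-- `HasMetricDerivOn f a b x L`: the metric derivative `md(f, x)` of the map `f : [a, b] → M` at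
the point `x` exists and equals `L`, that is, `dist (f (x + t)) (f x) / |t|` tends to `L` as
`t → 0` through nonzero `t` with `x + t ∈ [a, b]`. Only the values of `f` on `[a, b]` matter when
`x ∈ [a, b]`. -/
def HasMetricDerivOn {M : Type*} [MetricSpace M] (f : ℝ → M) (a b x L : ℝ) : Prop :=
  Tendsto (fun t : ℝ => dist (f (x + t)) (f x) / |t|)
    (𝓝[{t : ℝ | t ≠ 0 ∧ x + t ∈ Icc a b}] 0) (𝓝 L)

/-! Let `v` be the variation function of `f`; then `f = F ∘ v` with `F` 1-Lipschitz. Distances from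
`F` to a countable dense set give 1-Lipschitz real functions sending `v '' E` to null sets, so their
derivatives vanish a.e. there. Integrating the indicator of the set where some derivative is nonzero
gives one `H` that dominates all their increments, hence those of `F`, with `H' = 0` a.e. on `v ''
E`. At almost every `x ∈ E`, either `v' = 0` or the chain rule gives `(H ∘ v)' = 0`: points with `v'
≠ 0` that `v` sends into the exceptional null set form a null set. -/

/-- Near a point where the derivative within `T` is nonzero, a function expands distances to that
point by a definite factor. -/
theorem HasDerivWithinAt.exists_nat_abs_sub_le {h : ℝ → ℝ} {h' x : ℝ} {T : Set ℝ}
    (hd : HasDerivWithinAt h h' T x) (hne : h' ≠ 0) :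
    ∃ n : ℕ, ∀ y ∈ T, |y - x| < 1 / ((n : ℝ) + 1) → |y - x| ≤ ((n : ℝ) + 1) * |h y - h x| := by
  have hpos : 0 < |h'| := abs_pos.2 hne
  have hev := (hasDerivWithinAt_iff_isLittleO.1 hd).def (half_pos hpos)
  obtain ⟨δ, hδ, hball⟩ := Metric.mem_nhdsWithin_iff.1 hev
  obtain ⟨n, hn⟩ := exists_nat_one_div_lt (lt_min hδ (half_pos hpos))
  have hn0 : (0 : ℝ) < (n : ℝ) + 1 := by positivity
  refine ⟨n, fun y hy hyx => ?_⟩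
  have hmem : y ∈ Metric.ball x δ ∩ T :=
    ⟨by rw [Metric.mem_ball, Real.dist_eq]; exact hyx.trans (hn.trans_le (min_le_left _ _)), hy⟩
  have hle : |h y - h x - (y - x) * h'| ≤ |h'| / 2 * |y - x| := by
    simpa [Real.norm_eq_abs] using hball hmem
  have htri : |y - x| * |h'| ≤ |h y - h x| + |h y - h x - (y - x) * h'| := by
    rw [← abs_mul]
    calc |(y - x) * h'| = |(h y - h x) - (h y - h x - (y - x) * h')| := by congr 1; ring
      _ ≤ _ := abs_sub _ _
  have hc : 1 / ((n : ℝ) + 1) ≤ |h'| / 2 := (hn.trans_le (min_le_right _ _)).le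
  have hmul : 1 / ((n : ℝ) + 1) * |y - x| ≤ |h y - h x| := by
    have := mul_le_mul_of_nonneg_right hc (abs_nonneg (y - x))
    nlinarith
  calc |y - x| = ((n : ℝ) + 1) * (1 / ((n : ℝ) + 1) * |y - x|) := by field_simp
    _ ≤ _ := mul_le_mul_of_nonneg_left hmul hn0.le

/-- If a real function has a nonzero derivative within `T ⊇ S` at each point of `S` and the image
of `S` is Lebesgue null, then `S` is Lebesgue null. -/
theorem volume_eq_zero_of_image_of_hasDerivWithinAt_ne_zero {h : ℝ → ℝ} {S T : Set ℝ} (hST : S ⊆ T)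
    (hd : ∀ x ∈ S, ∃ h', h' ≠ 0 ∧ HasDerivWithinAt h h' T x) (h0 : volume (h '' S) = 0) :
    volume S = 0 := by
  let P : ℕ → Set ℝ := fun n => {x ∈ S | ∀ y ∈ T, |y - x| < 1 / ((n : ℝ) + 1) →
    |y - x| ≤ ((n : ℝ) + 1) * |h y - h x|}
  have hcover : S ⊆ ⋃ n, P n := fun x hx => by
    obtain ⟨h', hne, hder⟩ := hd x hx
    obtain ⟨n, hn⟩ := hder.exists_nat_abs_sub_le hne
    exact mem_iUnion.2 ⟨n, hx, hn⟩
  refine measure_mono_null hcover (measure_iUnion_null fun n => ?_)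
  have hn0 : (0 : ℝ) < 1 / ((n : ℝ) + 1) := by positivity
  refine measure_null_of_locally_null _ fun x _ => ?_
  -- Half the radius keeps any two points of `u` within `1 / (n + 1)`, so `h` has a Lipschitz
  -- inverse on `h '' u`.
  set u := P n ∩ Metric.ball x (1 / ((n : ℝ) + 1) / 2)
  refine ⟨u, inter_mem self_mem_nhdsWithin
    (mem_nhdsWithin_of_mem_nhds (Metric.ball_mem_nhds x (half_pos hn0))), ?_⟩
  have hanti : ∀ y ∈ u, ∀ z ∈ u, |y - z| ≤ ((n : ℝ) + 1) * |h y - h z| := by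
    intro y hy z hz
    refine hz.1.2 y (hST hy.1.1) ?_
    rw [← Real.dist_eq]
    have h1 := Metric.mem_ball.1 hy.2
    have h2 := Metric.mem_ball'.1 hz.2
    have h3 := dist_triangle y x z
    linarith
  have hinj : InjOn h u := fun y hy z hz hyz => by
    have := hanti y hy z hz
    rw [hyz, sub_self, abs_zero, mul_zero] at this
    exact sub_eq_zero.1 (abs_nonpos_iff.1 this)
  have hlip : LipschitzOnWith ((n : NNReal) + 1) (Function.invFunOn h u) (h '' u) := by
    refine LipschitzOnWith.of_dist_le_mul ?_
    rintro _ ⟨y, hy, rfl⟩ _ ⟨z, hz, rfl⟩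
    rw [hinj.leftInvOn_invFunOn hy, hinj.leftInvOn_invFunOn hz, Real.dist_eq, Real.dist_eq]
    simpa using hanti y hy z hz
  have himage := hlip.hausdorffMeasure_image_le zero_le_one
  rw [hinj.leftInvOn_invFunOn.image_image, hausdorffMeasure_real,
    measure_mono_null (image_mono fun y hy => hy.1.1) h0, mul_zero] at himage
  exact nonpos_iff_eq_zero.1 himage

/-- A countable family of `1`-Lipschitz functions with null images of `A` has increments controlled
by those of a single function whose derivative vanishes almost everywhere on `A`. -/
theorem exists_hasDerivAt_zero_of_image_null {ι : Type*} [Countable ι] {G : ι → ℝ → ℝ} {A : Set ℝ}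
    (hG : ∀ i, LipschitzWith 1 (G i)) (hA : ∀ i, volume (G i '' A) = 0) :
    ∃ H : ℝ → ℝ, (∀ i s t, |G i s - G i t| ≤ |H s - H t|) ∧
      ∀ᵐ s, s ∈ A → HasDerivAt H 0 s := by
  let Z : Set ℝ := ⋂ i, {s | deriv (G i) s = 0}
  have hZ : MeasurableSet Z := MeasurableSet.iInter fun i =>
    measurableSet_eq_fun (measurable_deriv (G i)) measurable_const
  have hAZ : ∀ᵐ s, s ∈ A → s ∈ Z := by
    have hi : ∀ i, ∀ᵐ s, s ∈ A → deriv (G i) s = 0 := fun i => by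
      have hnull : volume {s ∈ A | DifferentiableAt ℝ (G i) s ∧ deriv (G i) s ≠ 0} = 0 :=
        volume_eq_zero_of_image_of_hasDerivWithinAt_ne_zero (h := G i) (subset_univ _)
          (fun s hs => ⟨_, hs.2.2, hs.2.1.hasDerivAt.hasDerivWithinAt⟩)
          (measure_mono_null (image_mono fun s hs => hs.1) (hA i))
      filter_upwards [(hG i).ae_differentiableAt_real, measure_eq_zero_iff_ae_notMem.1 hnull]
        with s hs hs' hsA
      by_contra hne
      exact hs' ⟨hsA, hs, hne⟩
    filter_upwards [ae_all_iff.2 hi] with s hs hsA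
    exact mem_iInter.2 fun i => hs i hsA
  -- `|deriv (G i)| ≤ m` everywhere, for all `i` at once.
  let m : ℝ → ℝ := Zᶜ.indicator fun _ => 1
  have hm : LocallyIntegrable m volume := (locallyIntegrable_const (1 : ℝ)).indicator hZ.compl
  have hmi : ∀ s t, IntervalIntegrable m volume s t := fun s t =>
    intervalIntegrable_iff.2 ((hm.integrableOn_isCompact isCompact_uIcc).mono_set uIoc_subset_uIcc)
  refine ⟨fun t => ∫ u in (0 : ℝ)..t, m u, fun i s t => ?_, ?_⟩
  · rw [intervalIntegral.integral_interval_sub_left (hmi _ _) (hmi _ _),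
      ← ((hG i).lipschitzOnWith (s := uIcc t s)).absolutelyContinuousOnInterval.integral_deriv_eq_sub,
      ← Real.norm_eq_abs]
    refine intervalIntegral.norm_integral_le_abs_of_norm_le (.of_forall fun u => ?_) (hmi _ _)
    by_cases hu : u ∈ Z
    · rw [mem_iInter.1 hu i, norm_zero]
      exact indicator_nonneg (fun _ _ => zero_le_one) _
    · have : m u = 1 := indicator_of_mem (show u ∈ Zᶜ from hu) _
      rw [this]
      simpa using norm_deriv_le_of_lipschitz (hG i) (x₀ := u)
  · filter_upwards [hAZ, LocallyIntegrable.ae_hasDerivAt_integral hm] with s hs hder hsA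
    have : m s = 0 := indicator_of_notMem (not_not.2 (hs hsA)) _
    simpa [this] using hder 0

theorem BoundedVariationOn.dist_le_abs_variationOnFromTo_sub {M : Type*} [PseudoMetricSpace M]
    {f : ℝ → M} {s : Set ℝ} (hf : BoundedVariationOn f s) {a x y : ℝ} (ha : a ∈ s) (hx : x ∈ s)
    (hy : y ∈ s) :
    dist (f x) (f y) ≤ |variationOnFromTo f s a x - variationOnFromTo f s a y| := by
  wlog hxy : x ≤ y generalizing x y
  · rw [dist_comm, abs_sub_comm]
    exact this hy hx (le_of_not_ge hxy)
  have hloc := hf.locallyBoundedVariationOn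
  rw [abs_sub_comm, variationOnFromTo.sub_right hloc ha hy hx,
    variationOnFromTo.eq_of_le f s hxy, dist_edist]
  exact (ENNReal.toReal_mono (hloc x y hx hy)
    (eVariationOn.edist_le f ⟨hx, le_rfl, hxy⟩ ⟨hy, hxy, le_rfl⟩)).trans (le_abs_self _)

/-- A map with increments dominated by those of a real function with zero derivative has zero
metric derivative. -/
theorem HasDerivWithinAt.hasMetricDerivOn_zero {M : Type*} [MetricSpace M] {f : ℝ → M} {g : ℝ → ℝ}
    {a b x : ℝ} (hg : HasDerivWithinAt g 0 (Icc a b) x)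
    (hfg : ∀ y ∈ Icc a b, dist (f y) (f x) ≤ |g y - g x|) : HasMetricDerivOn f a b x 0 := by
  have hslope := (hasDerivWithinAt_iff_tendsto_slope.1 hg).abs
  rw [abs_zero] at hslope
  have hshift : Tendsto (fun t : ℝ => x + t) (𝓝[{t : ℝ | t ≠ 0 ∧ x + t ∈ Icc a b}] 0)
      (𝓝[Icc a b \ {x}] x) := by
    refine tendsto_nhdsWithin_iff.2 ⟨?_, ?_⟩
    · have : Tendsto (fun t : ℝ => x + t) (𝓝 0) (𝓝 (x + 0)) := (continuous_const_add x).tendsto 0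
      rw [add_zero] at this
      exact this.mono_left nhdsWithin_le_nhds
    · filter_upwards [self_mem_nhdsWithin] with t ht
      exact ⟨ht.2, by simpa using ht.1⟩
  refine tendsto_of_tendsto_of_tendsto_of_le_of_le' tendsto_const_nhds (hslope.comp hshift)
    (.of_forall fun t => by positivity) ?_
  filter_upwards [self_mem_nhdsWithin] with t ht
  have : |slope g x (x + t)| = |g (x + t) - g x| / |t| := by
    rw [slope_def_field, add_sub_cancel_left, abs_div]
  simp only [Function.comp_apply, this]
  exact div_le_div_of_nonneg_right (hfg _ ht.2) (abs_nonneg t)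

/-- If `f` has increments dominated by those of a real function `v`, a separable image of `s`, and
maps `E ⊆ s` to an `ℋ¹`-null set, then its increments are dominated by those of `H ∘ v` for a
function `H` with zero derivative almost everywhere on `v '' E`. -/
theorem exists_dist_le_comp_of_hausdorffMeasure_image_null {M : Type*} [MetricSpace M]
    [MeasurableSpace M] [BorelSpace M] {f : ℝ → M} {v : ℝ → ℝ} {s E : Set ℝ}
    (hfv : ∀ x ∈ s, ∀ y ∈ s, dist (f x) (f y) ≤ |v x - v y|)
    (hsep : TopologicalSpace.IsSeparable (f '' s)) (hEs : E ⊆ s)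
    (hE : Measure.hausdorffMeasure (1 : ℝ) (f '' E) = 0) :
    ∃ H : ℝ → ℝ, (∀ x ∈ s, ∀ y ∈ s, dist (f x) (f y) ≤ |H (v x) - H (v y)|) ∧
      ∀ᵐ u, u ∈ v '' E → HasDerivAt H 0 u := by
  obtain ⟨c, hc, hdense⟩ := hsep
  have : Countable c := hc.to_subtype
  have hσ : ∀ u ∈ v '' s, Function.invFunOn v s u ∈ s ∧ v (Function.invFunOn v s u) = u :=
    fun u hu => ⟨Function.invFunOn_mem hu, Function.invFunOn_eq hu⟩
  have hext : ∀ z : c, ∃ g : ℝ → ℝ, LipschitzWith 1 g ∧ ∀ x ∈ s, g (v x) = dist (f x) z := by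
    intro z
    -- The choice of preimage is immaterial: by `hfv`, `v x = v y` forces `f x = f y`.
    have hlip : LipschitzOnWith 1 (fun u => dist (f (Function.invFunOn v s u)) z) (v '' s) := by
      refine LipschitzOnWith.of_dist_le_mul fun u hu w hw => ?_
      rw [Real.dist_eq, Real.dist_eq, NNReal.coe_one, one_mul]
      refine (abs_dist_sub_le _ _ _).trans ((hfv _ (hσ u hu).1 _ (hσ w hw).1).trans_eq ?_)
      rw [(hσ u hu).2, (hσ w hw).2]
    obtain ⟨g, hg, heq⟩ := hlip.extend_real
    refine ⟨g, hg, fun x hx => ?_⟩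
    have hvx := hσ (v x) (mem_image_of_mem v hx)
    have hzero := hfv _ hvx.1 x hx
    rw [hvx.2, sub_self, abs_zero] at hzero
    rw [← heq (mem_image_of_mem v hx)]
    simp only [dist_le_zero.1 hzero]
  choose G hG hGv using hext
  have hnull : ∀ z, volume (G z '' (v '' E)) = 0 := fun z => by
    have himage : G z '' (v '' E) = (fun p => dist p (z : M)) '' (f '' E) := by
      rw [image_image, image_image]
      exact image_congr fun x hx => hGv z x (hEs hx)
    rw [himage, ← hausdorffMeasure_real]
    have := (LipschitzWith.dist_left (z : M)).hausdorffMeasure_image_le zero_le_one (f '' E)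
    rw [hE, mul_zero] at this
    exact nonpos_iff_eq_zero.1 this
  obtain ⟨H, hH, hder⟩ := exists_hasDerivAt_zero_of_image_null hG hnull
  refine ⟨H, fun x hx y hy => le_of_forall_pos_le_add fun ε hε => ?_, hder⟩
  -- For `z` near `f y`, the difference of distances to `z` nearly equals `dist (f x) (f y)`.
  obtain ⟨z, hz, hyz⟩ := Metric.mem_closure_iff.1 (hdense (mem_image_of_mem f hy)) (ε / 2)
    (half_pos hε)
  have h1 := hH ⟨z, hz⟩ (v x) (v y)
  rw [hGv _ x hx, hGv _ y hy] at h1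
  have h2 := dist_triangle_right (f x) (f y) z
  have h3 := (le_abs_self _).trans h1
  linarith

theorem theorem3p12 {M : Type*} [MetricSpace M] [MeasurableSpace M] [BorelSpace M]
    (a b : ℝ) (f : ℝ → M)
    (hcont : ContinuousOn f (Icc a b))
    (hbv : BoundedVariationOn f (Icc a b))
    (E : Set ℝ) (hEsub : E ⊆ Icc a b)
    (hEmeas : NullMeasurableSet E (volume : Measure ℝ))
    (hE : Measure.hausdorffMeasure (1 : ℝ) (f '' E) = 0) :
    ∀ᵐ x ∂(volume : Measure ℝ), x ∈ E → HasMetricDerivOn f a b x 0 := by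
  rcases E.eq_empty_or_nonempty with rfl | ⟨x₀, hx₀⟩
  · simp
  have ha : a ∈ Icc a b := left_mem_Icc.2 ((hEsub hx₀).1.trans (hEsub hx₀).2)
  set v := variationOnFromTo f (Icc a b) a
  have hfv : ∀ x ∈ Icc a b, ∀ y ∈ Icc a b, dist (f x) (f y) ≤ |v x - v y| :=
    fun x hx y hy => hbv.dist_le_abs_variationOnFromTo_sub ha hx hy
  obtain ⟨H, hfH, hH⟩ := exists_dist_le_comp_of_hausdorffMeasure_image_null hfv
    (isCompact_Icc.image_of_continuousOn hcont).isSeparable hEsub hE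
  have hbad : volume {x ∈ E | (∃ v', v' ≠ 0 ∧ HasDerivWithinAt v v' (Icc a b) x) ∧
      ¬ HasDerivAt H 0 (v x)} = 0 := by
    refine volume_eq_zero_of_image_of_hasDerivWithinAt_ne_zero (h := v)
      (fun x hx => hEsub hx.1) (fun x hx => hx.2.1) (measure_mono_null ?_ (ae_iff.1 hH))
    rintro _ ⟨x, hx, rfl⟩ himp
    exact hx.2.2 (himp (mem_image_of_mem v hx.1))
  have hmono : MonotoneOn v (Icc a b) :=
    variationOnFromTo.monotoneOn hbv.locallyBoundedVariationOn ha
  filter_upwards [hmono.ae_differentiableWithinAt_of_mem, measure_eq_zero_iff_ae_notMem.1 hbad]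
    with x hdiff hgood hxE
  have hx := hEsub hxE
  have hv := (hdiff hx).hasDerivWithinAt
  by_cases hv0 : derivWithin v (Icc a b) x = 0
  · rw [hv0] at hv
    exact hv.hasMetricDerivOn_zero fun y hy => hfv y hy x hx
  · have hHx : HasDerivAt H 0 (v x) := by
      by_contra hne
      exact hgood ⟨hxE, ⟨_, hv0, hv⟩, hne⟩
    have hcomp := hHx.comp_hasDerivWithinAt x hv
    rw [zero_mul] at hcomp
    exact hcomp.hasMetricDerivOn_zero fun y hy => hfH y hy x hx
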